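/- Let $\mathcal V$ be a variety of Heyting algebras, i.e. a class of Heyting algebras closed under homomorphic images, subalgebras and direct products. For a Heyting algebra $L$ let $\mathcal B(L)=\langle \mathrm{Fr}(L),g_L\rangle$ be the interior algebra consisting of the free Boolean extension $\mathrm{Fr}(L)$ of $L$ (the Boolean subalgebra of the power set of the set of prime ideals of $L$ generated by the image of the Stone embedding $a\mapsto\{I : a\notin I\}$, with $L$ identified with that image) and the interior operator $$g_L\big((-u_1+v_1)\cdots(-u_n+v_n)\big)=(u_1\Rightarrow v_1)\cdots(u_n\Rightarrow v_n)\qquad(u_i,v_i\in L).$$ Let $\rho^*(\mathcal V)=\mathrm{Eq}(\mathcal B[\mathcal V])$ be the variety generated by $\{\mathcal B(L):L\in\mathcal V\}$, and suppose that $\rho^*(\mathcal V)$ is locally finite, i.e. every finitely generated subalgebra of a member of $\rho^*(\mathcal V)$ is finite. Then for every $L\in\mathcal V$ $$t^{\mathcal V}(L)=t^{\rho^*(\mathcal V)}(\mathcal B(L)),$$ in the sense that, for each $t\in\{1,\omega,\infty,0\}$, $L$ has unification type $t$ in $\mathcal V$ if and only if $\mathcal B(L)$ has unification type $t$ in $\rho^*(\mathcal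 V)$. Here unification types are defined as follows. Let $\mathcal W$ be a variety and let $A\in\mathcal W$ be finitely presented relative to $\mathcal W$. (Algebras that are not finitely presented relative to $\mathcal W$ have no unification type in $\mathcal W$.) A unifier of $A$ in $\mathcal W$ is a pair $\langle u,B\rangle$ where $B\in\mathcal W$ is finitely presented in $\mathcal W$ and projective in $\mathcal W$ (with respect to surjective homomorphisms), and $u\colon A\to B$ is a homomorphism. A unifier $\langle u,B\rangle$ is more general than $\langle v,C\rangle$ if $v=h\circ u$ for some homomorphism $h\colon B\to C$; this quasiorders the unifiers of $A$. A $\mu$-set is a set $M$ of pairwise incomparable unifiers of $A$ such that for every unifier of $A$ some member of $M$ is more general than it. The algebra $A$ has unification type $1$ if there is a $\mu$-set with exactly one element, $\omega$ if there is a finite $\mu$-set with more than one element, $\infty$ if there is an infinite $\mu$-set, and $0$ if there is no $\mu$-set. (If $A$ has no unifier, it has none of these types.) -/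

import Mathlib

open FirstOrder CategoryTheory

universe u v

/-! ### Universal algebra over an algebraic language -/

/-- Algebras of type `L` with carrier in `Type u` (only used for languages without
relation symbols; homomorphisms are `A →[L] B`). -/
abbrev Alg (L : FirstOrder.Language.{0, 0}) : Type (u + 1) :=
  Bundled.{u} L.Structure

/-- The direct product of a family of algebras, with pointwise operations. -/
def Alg.pi {L : FirstOrder.Language.{0, 0}} {I : Type u} (A : I → Alg.{u} L) : Alg.{u} L where
  α := ∀ i, A i
  str :=
    { funMap := fun f x i => FirstOrder.Language.Structure.funMap f (fun k => x k i)
      RelMap := fun r x => ∀ i, FirstOrder.Language.Structure.RelMap r (fun k => x k i) }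

/-- A subalgebra regarded as an algebra. -/
def Alg.sub {L : FirstOrder.Language.{0, 0}} (A : Alg.{u} L) (S : L.Substructure A) : Alg.{u} L where
  α := S
  str := inferInstance

/-- A variety: a class of algebras closed under homomorphic images, subalgebras and
direct products (in particular, it is closed under isomorphism and contains the
one-element algebras). -/
structure IsVariety {L : FirstOrder.Language.{0, 0}} (V : Set (Alg.{u} L)) : Prop where
  image_mem : ∀ (A B : Alg.{u} L) (f : A →[L] B), A ∈ V → Function.Surjective f → B ∈ V
  sub_mem : ∀ (A : Alg.{u} L) (S : L.Substructure A), A ∈ V → A.sub S ∈ V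
  pi_mem : ∀ (I : Type u) (A : I → Alg.{u} L), (∀ i, A i ∈ V) → Alg.pi A ∈ V

/-- `Eq(K)`: the variety generated by the class `K`. -/
def generatedVariety {L : FirstOrder.Language.{0, 0}} (K : Set (Alg.{u} L)) : Set (Alg.{u} L) :=
  {A | ∀ W : Set (Alg.{u} L), IsVariety W → K ⊆ W → A ∈ W}

/-- A class of algebras is locally finite if every finitely generated subalgebra of each of
its members is finite. -/
def IsLocallyFiniteClass {L : FirstOrder.Language.{0, 0}} (V : Set (Alg.{u} L)) : Prop :=
  ∀ A ∈ V, ∀ S : L.Substructure A, S.FG → Finite S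

/-- `A` is finitely presented relative to `V`: it is the algebra of `V` given by finitely many
generators `a` and finitely many relations `R` (pairs of terms). -/
def IsFinitelyPresentedIn {L : FirstOrder.Language.{0, 0}} (V : Set (Alg.{u} L)) (A : Alg.{u} L) : Prop :=
  A ∈ V ∧ ∃ (n : ℕ) (a : Fin n → A) (R : Set (L.Term (Fin n) × L.Term (Fin n))),
    R.Finite ∧
    FirstOrder.Language.Substructure.closure L (Set.range a) = ⊤ ∧
    (∀ r ∈ R, r.1.realize a = r.2.realize a) ∧
    ∀ C ∈ V, ∀ c : Fin n → C, (∀ r ∈ R, r.1.realize c = r.2.realize c) →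
      ∃ h : A →[L] C, ∀ i, h (a i) = c i

/-- `A` is projective in `V` (with respect to surjective homomorphisms). -/
def IsProjectiveIn {L : FirstOrder.Language.{0, 0}} (V : Set (Alg.{u} L)) (A : Alg.{u} L) : Prop :=
  A ∈ V ∧ ∀ C ∈ V, ∀ D ∈ V, ∀ (p : C →[L] D) (f : A →[L] D), Function.Surjective p →
    ∃ g : A →[L] C, ∀ x, p (g x) = f x

/-! ### Unification types -/

/-- A unifier for `A` in `V`: a homomorphism from `A` to an algebra which is finitely presented
and projective in `V`. -/
structure Unifier {L : FirstOrder.Language.{0, 0}} (V : Set (Alg.{u} L)) (A : Alg.{u} L) where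
  target : Alg.{u} L
  hom : A →[L] target
  finitelyPresented : IsFinitelyPresentedIn V target
  projective : IsProjectiveIn V target

/-- `x` is more general than `y`: the homomorphism of `y` factors through that of `x`. -/
def Unifier.MoreGeneral {L : FirstOrder.Language.{0, 0}} {V : Set (Alg.{u} L)} {A : Alg.{u} L}
    (x y : Unifier V A) : Prop :=
  ∃ h : x.target →[L] y.target, ∀ a, h (x.hom a) = y.hom a

/-- The four unification types `1`, `ω`, `∞`, `0`. -/
inductive UnificationType
  | unitary
  | finitary
  | infinitary
  | nullary

/-- A `μ`-set of a quasiordered set: an antichain such that each element is below some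
element of it. -/
def IsMuSet {P : Type v} (le : P → P → Prop) (M : Set P) : Prop :=
  IsAntichain le M ∧ ∀ x, ∃ m ∈ M, le x m

/-- The quasiordered set `(P, le)` has type `t`. (If `P` is empty, then it has no type.) -/
def QuasiorderHasType {P : Type v} (le : P → P → Prop) : UnificationType → Prop
  | .unitary => ∃ M, IsMuSet le M ∧ M.ncard = 1
  | .finitary => ∃ M, IsMuSet le M ∧ M.Finite ∧ 1 < M.ncard
  | .infinitary => ∃ M, IsMuSet le M ∧ M.Infinite
  | .nullary => ¬ ∃ M, IsMuSet le M

/-- `A` has unification type `t` in `V`. This is defined for algebras `A` that are finitely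
presented in `V`; a unifier `x` is below `y` if `y` is more general than `x`. -/
def HasUnificationType {L : FirstOrder.Language.{0, 0}} (V : Set (Alg.{u} L)) (A : Alg.{u} L)
    (t : UnificationType) : Prop :=
  IsFinitelyPresentedIn V A ∧
    QuasiorderHasType (fun x y : Unifier V A => y.MoreGeneral x) t

/-! ### Heyting algebras and interior algebras as algebras -/

inductive HeytingOp : ℕ → Type
  | bot : HeytingOp 0
  | top : HeytingOp 0
  | sup : HeytingOp 2
  | inf : HeytingOp 2
  | imp : HeytingOp 2

/-- The language of Heyting algebras. -/
def heytingLanguage : FirstOrder.Language.{0, 0} where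
  Functions := HeytingOp
  Relations := fun _ => Empty

/-- A Heyting algebra as an algebra of type `heytingLanguage`. -/
def ofHeyting (A : Type u) [HeytingAlgebra A] : Alg.{u} heytingLanguage where
  α := A
  str :=
    { funMap := fun {n} (f : HeytingOp n) =>
        match n, f with
        | _, .bot => fun _ => ⊥
        | _, .top => fun _ => ⊤
        | _, .sup => fun x => x 0 ⊔ x 1
        | _, .inf => fun x => x 0 ⊓ x 1
        | _, .imp => fun x => x 0 ⇨ x 1
      RelMap := fun r => Empty.elim r }

/-- The class of all Heyting algebras. -/
def heytingAlgebras : Set (Alg.{u} heytingLanguage) :=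
  {C | ∃ (A : Type u) (_ : HeytingAlgebra A), C = ofHeyting A}

/-- An interior algebra: a Boolean algebra with an interior operator. -/
class InteriorAlgebra (B : Type u) extends BooleanAlgebra B where
  interiorOp : B → B
  interiorOp_top : interiorOp ⊤ = ⊤
  interiorOp_inf : ∀ a b, interiorOp (a ⊓ b) = interiorOp a ⊓ interiorOp b
  interiorOp_le : ∀ a, interiorOp a ≤ a
  interiorOp_idem : ∀ a, interiorOp (interiorOp a) = interiorOp a

inductive InteriorOp : ℕ → Type
  | bot : InteriorOp 0
  | top : InteriorOp 0
  | sup : InteriorOp 2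
  | inf : InteriorOp 2
  | compl : InteriorOp 1
  | int : InteriorOp 1

/-- The language of interior algebras. -/
def interiorLanguage : FirstOrder.Language.{0, 0} where
  Functions := InteriorOp
  Relations := fun _ => Empty

/-- An interior algebra as an algebra of type `interiorLanguage`. -/
def ofInterior (B : Type u) [InteriorAlgebra B] : Alg.{u} interiorLanguage where
  α := B
  str :=
    { funMap := fun {n} (f : InteriorOp n) =>
        match n, f with
        | _, .bot => fun _ => ⊥
        | _, .top => fun _ => ⊤
        | _, .sup => fun x => x 0 ⊔ x 1
        | _, .inf => fun x => x 0 ⊓ x 1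
        | _, .compl => fun x => (x 0)ᶜ
        | _, .int => fun x => InteriorAlgebra.interiorOp (x 0)
      RelMap := fun r => Empty.elim r }

/-! ### The free Boolean extension and its interior operator -/

section FreeBooleanExtension

/-- The Stone embedding of a bounded distributive lattice into the power set of its set of
prime ideals. -/
def stoneMap (A : Type u) [DistribLattice A] [BoundedOrder A] (a : A) :
    Set {I : Order.Ideal A // I.IsPrime} :=
  {I | a ∉ I.1}

/-- The free Boolean extension of a bounded distributive lattice: the Boolean subalgebra of the
power set of the set of prime ideals generated by the image of the Stone embedding. -/
def FreeBooleanExtension (A : Type u) [DistribLattice A] [BoundedOrder A] : Type u :=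
  BooleanSubalgebra.closure (Set.range (stoneMap A))

namespace FreeBooleanExtension

noncomputable instance (A : Type u) [DistribLattice A] [BoundedOrder A] :
    BooleanAlgebra (FreeBooleanExtension A) :=
  inferInstanceAs (BooleanAlgebra (BooleanSubalgebra.closure (Set.range (stoneMap A))))

section Lattice

variable {A : Type u} [DistribLattice A] [BoundedOrder A]

/-- The embedding of a bounded distributive lattice into its free Boolean extension. -/
def incl (a : A) : FreeBooleanExtension A :=
  ⟨stoneMap A a, BooleanSubalgebra.subset_closure ⟨a, rfl⟩⟩

theorem stoneMap_sup (a b : A) : stoneMap A (a ⊔ b) = stoneMap A a ⊔ stoneMap A b := by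
  ext I
  simp only [stoneMap, Set.mem_ofPred_eq, Set.sup_eq_union, Set.mem_union,
    Order.Ideal.sup_mem_iff]
  tauto

theorem stoneMap_inf (a b : A) : stoneMap A (a ⊓ b) = stoneMap A a ⊓ stoneMap A b := by
  ext I
  simp only [stoneMap, Set.mem_ofPred_eq, Set.inf_eq_inter, Set.mem_inter_iff]
  constructor
  · intro h
    exact ⟨fun ha => h (I.1.lower inf_le_left ha), fun hb => h (I.1.lower inf_le_right hb)⟩
  · rintro ⟨ha, hb⟩ h
    exact (I.2.mem_or_mem h).elim ha hb

theorem stoneMap_bot : stoneMap A ⊥ = ⊥ := by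
  ext I
  simp [stoneMap]

theorem stoneMap_top : stoneMap A ⊤ = ⊤ := by
  ext I
  have := I.2.toIsProper
  simpa [stoneMap] using Order.Ideal.IsProper.top_notMem this

theorem stoneMap_le_iff {a b : A} : stoneMap A a ≤ stoneMap A b ↔ a ≤ b := by
  constructor
  · intro h
    by_contra hab
    have hd : Disjoint (Order.PFilter.principal a : Set A) (Order.Ideal.principal b : Set A) := by
      rw [Set.disjoint_left]
      intro x hx hx'
      exact hab (le_trans (Order.PFilter.mem_principal.1 hx) (Order.Ideal.mem_principal.1 hx'))
    obtain ⟨J, hJ, hbJ, hJa⟩ := DistribLattice.prime_ideal_of_disjoint_filter_ideal hd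
    have h1 : (⟨J, hJ⟩ : {I : Order.Ideal A // I.IsPrime}) ∈ stoneMap A a := fun ha =>
      Set.disjoint_left.1 hJa (Order.PFilter.mem_principal.2 le_rfl) ha
    exact h h1 (hbJ (Order.Ideal.mem_principal.2 le_rfl))
  · intro h I hI hb
    exact hI (I.1.lower h hb)

theorem incl_sup (a b : A) : incl (a ⊔ b) = incl a ⊔ incl b := Subtype.ext (stoneMap_sup a b)

theorem incl_inf (a b : A) : incl (a ⊓ b) = incl a ⊓ incl b := Subtype.ext (stoneMap_inf a b)

theorem incl_bot : incl (⊥ : A) = ⊥ := Subtype.ext stoneMap_bot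

theorem incl_top : incl (⊤ : A) = ⊤ := Subtype.ext stoneMap_top

theorem incl_le_iff {a b : A} : incl a ≤ incl b ↔ a ≤ b := stoneMap_le_iff

/-- The element `(-u₁ + v₁) · … · (-uₙ + vₙ)` for a finite set of pairs `(uᵢ, vᵢ)`. -/
noncomputable def clauses (s : Finset (A × A)) : FreeBooleanExtension A :=
  s.inf fun p => (incl p.1)ᶜ ⊔ incl p.2

theorem exists_clauses (a : FreeBooleanExtension A) : ∃ s : Finset (A × A), a = clauses s := by
  classical
  have hS : IsSublattice (Set.range (stoneMap A)) :=
    ⟨by rintro _ ⟨a, rfl⟩ _ ⟨b, rfl⟩; exact ⟨a ⊔ b, stoneMap_sup a b⟩,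
     by rintro _ ⟨a, rfl⟩ _ ⟨b, rfl⟩; exact ⟨a ⊓ b, stoneMap_inf a b⟩⟩
  obtain ⟨t, ht⟩ := (BooleanSubalgebra.mem_closure_iff_sup_sdiff hS ⟨⊥, stoneMap_bot⟩
    ⟨⊤, stoneMap_top⟩).1 (aᶜ).2
  have key : ∀ t : Finset (Set.range (stoneMap A) × Set.range (stoneMap A)),
      ∃ s : Finset (A × A),
        ((clauses s : FreeBooleanExtension A).1 = (t.sup fun x => x.1.1 \ x.2.1)ᶜ) := by
    intro t
    induction t using Finset.induction_on with
    | empty => exact ⟨∅, by simp [clauses]; rfl⟩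
    | insert x t _ ih =>
      obtain ⟨s, hs⟩ := ih
      obtain ⟨⟨_, u, rfl⟩, ⟨_, v, rfl⟩⟩ := x
      refine ⟨insert (u, v) s, ?_⟩
      rw [Finset.sup_insert, compl_sup, ← hs]
      simp only [clauses, Finset.inf_insert]
      rw [sdiff_eq, compl_inf, compl_compl]
      rfl
  obtain ⟨s, hs⟩ := key t
  refine ⟨s, ?_⟩
  rw [← compl_compl a]
  refine Subtype.ext ?_
  rw [hs, ← ht]
  rfl

end Lattice

variable {A : Type u} [HeytingAlgebra A]

/-- The element `(u₁ ⇒ v₁) · … · (uₙ ⇒ vₙ)` for a finite set of pairs `(uᵢ, vᵢ)`. -/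
def implications (s : Finset (A × A)) : A :=
  s.inf fun p => p.1 ⇨ p.2

theorem incl_le_clauses_iff (x : A) (s : Finset (A × A)) :
    incl x ≤ clauses s ↔ x ≤ implications s := by
  simp only [clauses, implications, Finset.le_inf_iff]
  refine forall₂_congr fun p _ => ?_
  rw [le_himp_iff, ← incl_le_iff (a := x ⊓ p.1), incl_inf, sup_comm, ← himp_eq, le_himp_iff]

/-- The operator `g` on the free Boolean extension of a Heyting algebra: write `a` as
`(-u₁ + v₁) · … · (-uₙ + vₙ)` and put `g a = (u₁ ⇒ v₁) · … · (uₙ ⇒ vₙ)`. By `int_clauses`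
below this does not depend on the representation. -/
noncomputable def int (a : FreeBooleanExtension A) : FreeBooleanExtension A :=
  incl (implications (exists_clauses a).choose)

theorem incl_le_int_iff (x : A) (a : FreeBooleanExtension A) : incl x ≤ int a ↔ incl x ≤ a := by
  conv_rhs => rw [(exists_clauses a).choose_spec]
  rw [incl_le_clauses_iff, int, incl_le_iff]

theorem int_clauses (s : Finset (A × A)) : int (clauses s) = incl (implications s) := by
  refine le_antisymm ?_ ?_
  · have h : incl (implications (exists_clauses (clauses s)).choose) ≤ int (clauses s) := le_rfl
    rw [incl_le_int_iff, incl_le_clauses_iff] at h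
    exact incl_le_iff.2 h
  · rw [incl_le_int_iff, incl_le_clauses_iff]

theorem exists_int_eq (a : FreeBooleanExtension A) : ∃ x : A, int a = incl x := ⟨_, rfl⟩

theorem int_incl (x : A) : int (incl x) = incl x := by
  obtain ⟨y, hy⟩ := exists_int_eq (incl x)
  refine le_antisymm ?_ ((incl_le_int_iff x _).2 le_rfl)
  rw [hy]
  exact (incl_le_int_iff y _).1 hy.ge

theorem int_le (a : FreeBooleanExtension A) : int a ≤ a := by
  obtain ⟨y, hy⟩ := exists_int_eq a
  rw [hy]
  exact (incl_le_int_iff y _).1 hy.ge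

theorem int_inf (a b : FreeBooleanExtension A) : int (a ⊓ b) = int a ⊓ int b := by
  obtain ⟨x, hx⟩ := exists_int_eq a
  obtain ⟨y, hy⟩ := exists_int_eq b
  obtain ⟨z, hz⟩ := exists_int_eq (a ⊓ b)
  refine le_antisymm (le_inf ?_ ?_) ?_
  · rw [hz, incl_le_int_iff, ← hz]
    exact (int_le _).trans inf_le_left
  · rw [hz, incl_le_int_iff, ← hz]
    exact (int_le _).trans inf_le_right
  · rw [hx, hy, ← incl_inf, incl_le_int_iff, incl_inf, ← hx, ← hy]
    exact inf_le_inf (int_le a) (int_le b)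

/-- The interior algebra `𝓑(A) = (Fr(A), g)` of a Heyting algebra `A`. -/
noncomputable instance : InteriorAlgebra (FreeBooleanExtension A) where
  interiorOp := int
  interiorOp_top := by rw [← incl_top, int_incl]
  interiorOp_inf := int_inf
  interiorOp_le := int_le
  interiorOp_idem := fun a => by
    obtain ⟨x, hx⟩ := exists_int_eq a
    rw [hx, int_incl]

end FreeBooleanExtension

end FreeBooleanExtension

/-- `ρ*(V) = Eq(𝓑[V])` for a class `V` of Heyting algebras. -/
noncomputable def rhoStar (V : Set (Alg.{u} heytingLanguage)) : Set (Alg.{u} interiorLanguage) :=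
  generatedVariety {C | ∃ (A : Type u) (_ : HeytingAlgebra A),
    ofHeyting A ∈ V ∧ C = ofInterior (FreeBooleanExtension A)}

/-! ### Quasiorders -/

/-! Passing to open elements turns interior algebras into Heyting algebras, and `𝓑` goes back. Every
homomorphism of interior algebras restricts to open elements (`exists_restrict`). Conversely, a
Heyting homomorphism between open elements extends to the interior algebras, provided that the
source is generated as a Boolean algebra by its open elements (`exists_lift`); the extension is then
unique (`hom_ext`).

The algebra `𝓑(L)` is so generated, with open elements `L`, but a member of `ρ*(V)` need not be.
What survives in the generated variety is the Grzegorczyk law and the fact that the open elements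
form an algebra of `V` (`exists_eq_ofInterior_of_mem_rhoStar`). A finite Grzegorczyk algebra is
again generated by its open elements (`IsGrz.closure_range_val`), and here local finiteness enters:
on both sides the finitely presented algebras are exactly the finite members, so every target of a
unifier is finite.

Restriction and extension transfer projectivity and factorizations. Thus the unifiers of `L` and of
`𝓑(L)` are linked by a relation that is total on both sides and preserves and reflects generality,
which forces equal types. -/

theorem IsMuSet.exists_image {P Q : Type*} {r : P → P → Prop} {s : Q → Q → Prop}
    (hs : ∀ y, s y y) {R : P → Q → Prop} (hl : ∀ x, ∃ y, R x y) (hr : ∀ y, ∃ x, R x y)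
    (hR : ∀ x y x' y', R x y → R x' y' → (r x x' ↔ s y y')) {M : Set P} (hM : IsMuSet r M) :
    ∃ φ : P → Q, Set.InjOn φ M ∧ IsMuSet s (φ '' M) := by
  choose φ hφ using hl
  refine ⟨φ, ?_, ?_, ?_⟩
  · intro x hx y hy hxy
    -- Members of `M` with equal images are comparable because `s` is reflexive, against the
    -- antichain property.
    by_contra hne
    exact hM.1 hx hy hne ((hR _ _ _ _ (hφ x) (hφ y)).2 (hxy ▸ hs _))
  · rintro _ ⟨x, hx, rfl⟩ _ ⟨y, hy, rfl⟩ hne hxy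
    exact hM.1 hx hy (fun h => hne (h ▸ rfl)) ((hR _ _ _ _ (hφ x) (hφ y)).2 hxy)
  · intro y
    obtain ⟨x, hx⟩ := hr y
    obtain ⟨m, hm, hxm⟩ := hM.2 x
    exact ⟨_, ⟨m, hm, rfl⟩, (hR _ _ _ _ hx (hφ m)).1 hxm⟩

/-- A relation suffices in place of a map: choosing one partner for each element carries μ-sets to
μ-sets of the same size, and no choice has to be canonical. -/
theorem QuasiorderHasType.of_rel {P Q : Type*} {r : P → P → Prop} {s : Q → Q → Prop}
    (hr' : ∀ x, r x x) (hs : ∀ y, s y y) {R : P → Q → Prop} (hl : ∀ x, ∃ y, R x y)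
    (hr : ∀ y, ∃ x, R x y) (hR : ∀ x y x' y', R x y → R x' y' → (r x x' ↔ s y y'))
    {t : UnificationType} (h : QuasiorderHasType r t) : QuasiorderHasType s t := by
  cases t with
  | unitary =>
    obtain ⟨M, hM, hc⟩ := h
    obtain ⟨φ, hφ, hM'⟩ := hM.exists_image hs hl hr hR
    exact ⟨_, hM', by rw [hφ.ncard_image, hc]⟩
  | finitary =>
    obtain ⟨M, hM, hf, hc⟩ := h
    obtain ⟨φ, hφ, hM'⟩ := hM.exists_image hs hl hr hR
    exact ⟨_, hM', hf.image φ, by rwa [hφ.ncard_image]⟩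
  | infinitary =>
    obtain ⟨M, hM, hf⟩ := h
    obtain ⟨φ, hφ, hM'⟩ := hM.exists_image hs hl hr hR
    exact ⟨_, hM', hf.image hφ⟩
  | nullary =>
    -- Nonexistence needs the opposite direction: a μ-set of `Q` is carried back to `P` along the
    -- converse relation.
    rintro ⟨M, hM⟩
    obtain ⟨φ, -, hM'⟩ := hM.exists_image (R := fun y x => R x y) hr' hr hl
      fun x y x' y' h h' => (hR _ _ _ _ h h').symm
    exact h ⟨_, hM'⟩

theorem quasiorderHasType_iff_of_rel {P Q : Type*} {r : P → P → Prop} {s : Q → Q → Prop}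
    (hr' : ∀ x, r x x) (hs : ∀ y, s y y) {R : P → Q → Prop} (hl : ∀ x, ∃ y, R x y)
    (hr : ∀ y, ∃ x, R x y) (hR : ∀ x y x' y', R x y → R x' y' → (r x x' ↔ s y y'))
    (t : UnificationType) : QuasiorderHasType r t ↔ QuasiorderHasType s t :=
  ⟨fun h => h.of_rel hr' hs hl hr hR, fun h => h.of_rel (R := fun y x => R x y) hs hr' hr hl
    fun _ _ _ _ h h' => (hR _ _ _ _ h h').symm⟩

theorem Unifier.MoreGeneral.refl {L : FirstOrder.Language.{0, 0}} {V : Set (Alg.{u} L)}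
    {A : Alg.{u} L} (x : Unifier V A) : x.MoreGeneral x :=
  ⟨FirstOrder.Language.Hom.id L _, fun _ => rfl⟩

/-! ### Universal algebra -/

section UniversalAlgebra

open FirstOrder.Language

variable {L : FirstOrder.Language.{0, 0}}

theorem IsFinitelyPresentedIn.exists_closure_eq_top {V : Set (Alg.{u} L)} {A : Alg.{u} L}
    (h : IsFinitelyPresentedIn V A) :
    ∃ (n : ℕ) (a : Fin n → A), Substructure.closure L (Set.range a) = ⊤ := by
  obtain ⟨-, n, a, -, -, ha, -⟩ := h
  exact ⟨n, a, ha⟩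

theorem IsFinitelyPresentedIn.finite {V : Set (Alg.{u} L)} (hV : IsLocallyFiniteClass V)
    {A : Alg.{u} L} (h : IsFinitelyPresentedIn V A) : Finite A := by
  obtain ⟨n, a, ha⟩ := h.exists_closure_eq_top
  have : Finite (⊤ : L.Substructure A) :=
    hV A h.1 ⊤ (ha ▸ Substructure.fg_closure (Set.finite_range a))
  exact Finite.of_injective (fun x : A => (⟨x, trivial⟩ : (⊤ : L.Substructure A)))
    fun x y h => congrArg Subtype.val h

/-- The class of all algebras satisfying a set of equations. -/
def equationalClass (E : Set (L.Term ℕ × L.Term ℕ)) : Set (Alg.{u} L) :=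
  {A | ∀ p ∈ E, ∀ v : ℕ → A, p.1.realize v = p.2.realize v}

theorem mem_equationalClass_of_surjective {E : Set (L.Term ℕ × L.Term ℕ)} {A B : Alg.{u} L}
    (f : A →[L] B) (hf : Function.Surjective f) (hA : A ∈ equationalClass E) :
    B ∈ equationalClass E := by
  intro p hp v
  obtain ⟨w, rfl⟩ : ∃ w : ℕ → A, v = f ∘ w :=
    ⟨fun n => (hf (v n)).choose, funext fun n => (hf (v n)).choose_spec.symm⟩
  rw [HomClass.realize_term, HomClass.realize_term, hA p hp]

theorem mem_equationalClass_of_jointly_injective {E : Set (L.Term ℕ × L.Term ℕ)}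
    {A : Alg.{u} L} {I : Type*} {B : I → Alg.{u} L} (f : ∀ i, A →[L] B i)
    (hf : ∀ x y, (∀ i, f i x = f i y) → x = y) (hB : ∀ i, B i ∈ equationalClass E) :
    A ∈ equationalClass E := by
  intro p hp v
  refine hf _ _ fun i => ?_
  rw [← HomClass.realize_term, ← HomClass.realize_term, hB i p hp]

variable [L.IsAlgebraic]

/-- A map preserving the operations, as a homomorphism. -/
def Alg.homMk {A B : Alg.{u} L} (f : A → B)
    (hf : ∀ {n} (o : L.Functions n) (x : Fin n → A),
      f (Structure.funMap o x) = Structure.funMap o (f ∘ x)) : A →[L] B where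
  toFun := f
  map_fun' := hf
  map_rel' := fun r => isEmptyElim r

/-- Take all elements as generators and the full operation tables as relations; these are finitely
many since the language is finite. -/
theorem isFinitelyPresentedIn_of_finite [Finite (Σ n, L.Functions n)] {V : Set (Alg.{u} L)}
    {A : Alg.{u} L} (hA : A ∈ V) [Finite A] : IsFinitelyPresentedIn V A := by
  obtain ⟨n, ⟨e⟩⟩ := Finite.exists_equiv_fin A
  let rel : (Σ o : (Σ n, L.Functions n), (Fin o.1 → Fin n)) →
      L.Term (Fin n) × L.Term (Fin n) := fun p =>
    (Term.func p.1.2 (fun i => Term.var (p.2 i)),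
      Term.var (e (Structure.funMap p.1.2 (fun i => e.symm (p.2 i)))))
  refine ⟨hA, n, e.symm, Set.range rel, Set.finite_range _, ?_, ?_, ?_⟩
  · rw [e.symm.surjective.range_eq]
    exact Substructure.closure_univ
  · rintro _ ⟨p, rfl⟩
    simp [rel]
  · intro C hC c hc
    refine ⟨Alg.homMk (fun a => c (e a)) ?_, fun i => congrArg c (e.apply_symm_apply i)⟩
    intro k o x
    have := hc _ ⟨⟨⟨k, o⟩, fun i => e (x i)⟩, rfl⟩
    simp only [rel, Term.realize_func, Term.realize_var, Equiv.symm_apply_apply] at this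
    exact this.symm

theorem IsVariety.mem_of_injective {V : Set (Alg.{u} L)} (hV : IsVariety V) {A B : Alg.{u} L}
    (f : A →[L] B) (hf : Function.Injective f) (hB : B ∈ V) : A ∈ V := by
  have key : ∀ y : B.sub f.range, ∃ x : A, f x = y.1 := fun y => Hom.mem_range.1 y.2
  choose g hg using key
  refine hV.image_mem (B.sub f.range) A (Alg.homMk g ?_) (hV.sub_mem B f.range hB) ?_
  · intro n o x
    apply hf
    rw [hg, f.map_fun]
    change Structure.funMap o (fun i => (x i).1) = _
    congr 1
    ext i
    exact (hg (x i)).symm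
  · intro x
    exact ⟨⟨f x, Hom.mem_range.2 ⟨x, rfl⟩⟩, hf (hg _)⟩

/-- The projections of a direct product. -/
def Alg.proj {I : Type u} (A : I → Alg.{u} L) (i : I) : Alg.pi A →[L] A i :=
  Alg.homMk (fun x => x i) fun _ _ => rfl

theorem IsVariety.mem_of_jointly_injective {V : Set (Alg.{u} L)} (hV : IsVariety V)
    {A : Alg.{u} L} {I : Type u} {B : I → Alg.{u} L} (f : ∀ i, A →[L] B i)
    (hf : ∀ x y, (∀ i, f i x = f i y) → x = y) (hB : ∀ i, B i ∈ V) : A ∈ V := by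
  refine hV.mem_of_injective (B := Alg.pi B) (Alg.homMk (fun x i => f i x) ?_) ?_
    (hV.pi_mem I B hB)
  · intro n o x
    funext i
    exact (f i).map_fun o x
  · intro x y h
    exact hf x y fun i => congrFun h i

/-- Subalgebras and products are both jointly injective families of homomorphisms into members: a
single inclusion, or the projections. -/
theorem isVariety_of_jointly_injective {W : Set (Alg.{u} L)}
    (himage : ∀ (A B : Alg.{u} L) (f : A →[L] B), A ∈ W → Function.Surjective f → B ∈ W)
    (hsub : ∀ (A : Alg.{u} L) (I : Type u) (B : I → Alg.{u} L) (f : ∀ i, A →[L] B i),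
      (∀ x y, (∀ i, f i x = f i y) → x = y) → (∀ i, B i ∈ W) → A ∈ W) : IsVariety W where
  image_mem := himage
  sub_mem A S hA := hsub (A.sub S) PUnit (fun _ => A) (fun _ => S.subtype.toHom)
    (fun _ _ h => Subtype.ext (h PUnit.unit)) fun _ => hA
  pi_mem I A hA := hsub (Alg.pi A) I A (Alg.proj A) (fun _ _ h => funext h) hA

end UniversalAlgebra

/-! ### Heyting algebras and interior algebras as algebras -/

instance : heytingLanguage.IsAlgebraic := fun _ => inferInstanceAs (IsEmpty Empty)

instance : interiorLanguage.IsAlgebraic := fun _ => inferInstanceAs (IsEmpty Empty)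

instance : Finite (Σ n, heytingLanguage.Functions n) := by
  refine Finite.of_surjective (α := Fin 5) ![⟨0, HeytingOp.bot⟩, ⟨0, HeytingOp.top⟩,
    ⟨2, HeytingOp.sup⟩, ⟨2, HeytingOp.inf⟩, ⟨2, HeytingOp.imp⟩] ?_
  rintro ⟨_, _ | _⟩
  exacts [⟨0, rfl⟩, ⟨1, rfl⟩, ⟨2, rfl⟩, ⟨3, rfl⟩, ⟨4, rfl⟩]

instance : Finite (Σ n, interiorLanguage.Functions n) := by
  refine Finite.of_surjective (α := Fin 6) ![⟨0, InteriorOp.bot⟩, ⟨0, InteriorOp.top⟩,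
    ⟨2, InteriorOp.sup⟩, ⟨2, InteriorOp.inf⟩, ⟨1, InteriorOp.compl⟩, ⟨1, InteriorOp.int⟩] ?_
  rintro ⟨_, _ | _⟩
  exacts [⟨0, rfl⟩, ⟨1, rfl⟩, ⟨2, rfl⟩, ⟨3, rfl⟩, ⟨4, rfl⟩, ⟨5, rfl⟩]

section Homomorphisms

variable {H K : Type u} [HeytingAlgebra H] [HeytingAlgebra K]

/-- A homomorphism of Heyting algebras as a homomorphism of algebras. -/
def HeytingHom.toAlgHom (f : HeytingHom H K) : ofHeyting H →[heytingLanguage] ofHeyting K :=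
  Alg.homMk (A := ofHeyting H) (B := ofHeyting K) f (by
    rintro _ (_ | _) x
    exacts [f.map_bot', map_top f, f.map_sup' _ _, f.map_inf' _ _, f.map_himp' _ _])

/-- A homomorphism of algebras between Heyting algebras. -/
def HeytingHom.ofAlgHom (h : ofHeyting H →[heytingLanguage] ofHeyting K) : HeytingHom H K where
  toFun := h
  map_sup' a b := h.map_fun HeytingOp.sup (![a, b] : Fin 2 → H)
  map_inf' a b := h.map_fun HeytingOp.inf (![a, b] : Fin 2 → H)
  map_bot' := h.map_fun HeytingOp.bot (![] : Fin 0 → H)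
  map_himp' a b := h.map_fun HeytingOp.imp (![a, b] : Fin 2 → H)

variable {M N : Type u} [InteriorAlgebra M] [InteriorAlgebra N]

open InteriorAlgebra

/-- A bounded lattice homomorphism preserving the interior operators, as a homomorphism of
algebras. -/
def BoundedLatticeHom.toAlgHom (f : BoundedLatticeHom M N)
    (hf : ∀ a, f (interiorOp a) = interiorOp (f a)) :
    ofInterior M →[interiorLanguage] ofInterior N :=
  Alg.homMk (A := ofInterior M) (B := ofInterior N) f (by
    rintro _ (_ | _) x
    exacts [f.map_bot', f.map_top', f.map_sup' _ _, f.map_inf' _ _, map_compl' f _, hf _])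

/-- The bounded lattice homomorphism underlying a homomorphism of interior algebras. -/
def BoundedLatticeHom.ofAlgHom (h : ofInterior M →[interiorLanguage] ofInterior N) :
    BoundedLatticeHom M N where
  toFun := h
  map_sup' a b := h.map_fun InteriorOp.sup (![a, b] : Fin 2 → M)
  map_inf' a b := h.map_fun InteriorOp.inf (![a, b] : Fin 2 → M)
  map_bot' := h.map_fun InteriorOp.bot (![] : Fin 0 → M)
  map_top' := h.map_fun InteriorOp.top (![] : Fin 0 → M)

theorem BoundedLatticeHom.ofAlgHom_interiorOp
    (h : ofInterior M →[interiorLanguage] ofInterior N) (a : M) :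
    ofAlgHom h (interiorOp a) = interiorOp (ofAlgHom h a) :=
  h.map_fun InteriorOp.int (![a] : Fin 1 → M)

end Homomorphisms

/-! ### Interior algebras -/

namespace InteriorAlgebra

variable {M : Type u} [InteriorAlgebra M]

theorem interiorOp_mono : Monotone (interiorOp : M → M) := fun a b h => by
  rw [← inf_eq_left.2 h, interiorOp_inf]
  exact inf_le_right

theorem le_interiorOp {a b : M} (ha : interiorOp a = a) (h : a ≤ b) : a ≤ interiorOp b :=
  ha.symm.trans_le (interiorOp_mono h)

/-- The closure operator of an interior algebra. -/
def cl (a : M) : M := (interiorOp aᶜ)ᶜ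

theorem le_cl (a : M) : a ≤ cl a := le_compl_comm.1 (interiorOp_le _)

theorem cl_mono : Monotone (cl : M → M) := fun _ _ h =>
  compl_le_compl (interiorOp_mono (compl_le_compl h))

theorem interiorOp_compl_cl (a : M) : interiorOp (cl a)ᶜ = (cl a)ᶜ := by
  simp [cl, interiorOp_idem]

theorem cl_le {a c : M} (hc : interiorOp cᶜ = cᶜ) (h : a ≤ c) : cl a ≤ c :=
  compl_le_iff_compl_le.1 (le_interiorOp hc (compl_le_compl h))

theorem cl_bot : cl (⊥ : M) = ⊥ := by simp [cl, interiorOp_top]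

/-- The part of the closure of `a` in an open element `o` lies in the closure of `o ⊓ a`. -/
theorem inf_cl_le {o : M} (ho : interiorOp o = o) (a : M) : o ⊓ cl a ≤ cl (o ⊓ a) := by
  have h : o ⊓ (cl (o ⊓ a))ᶜ ≤ (cl a)ᶜ := by
    rw [cl, cl, compl_compl, compl_compl, ← ho, ← interiorOp_inf, ho]
    refine interiorOp_mono ?_
    rw [compl_inf, inf_sup_left, inf_compl_self, bot_sup_eq]
    exact inf_le_right
  rw [← himp_bot (cl a), le_himp_iff] at h
  rw [← compl_compl (cl (o ⊓ a)), ← himp_bot (cl (o ⊓ a))ᶜ, le_himp_iff, inf_right_comm]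
  exact h

/-! ### Grzegorczyk algebras -/

variable (M) in
/-- Grzegorczyk algebras, with the axiom in terms of the closure operator. -/
def IsGrz : Prop := ∀ a : M, a ≤ cl (a ⊓ (cl (cl a ⊓ aᶜ))ᶜ)

theorem isGrz_of_forall_eq_bot (h : ∀ b : M, b ≤ cl (cl b ⊓ bᶜ) → b = ⊥) : IsGrz M := by
  intro a
  set d := cl (cl a ⊓ aᶜ) with hd
  set o := (cl (a ⊓ dᶜ))ᶜ with ho
  have hoo : interiorOp o = o := interiorOp_compl_cl _
  have hb : a ⊓ o = ⊥ := by
    -- Put `b = a ⊓ o`. It lies below `d`, since `a ⊓ dᶜ` lies below `oᶜ`. Cutting with the open `o`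
    -- then replaces `cl a ⊓ aᶜ` by `cl b ⊓ bᶜ` under the closure.
    apply h
    have h1 : a ⊓ o ≤ d := by
      rw [← sdiff_eq_bot_iff, sdiff_eq, inf_right_comm, ← le_bot_iff]
      exact (inf_le_inf_right _ (le_cl _)).trans (inf_compl_self _).le
    have h2 : o ⊓ (cl a ⊓ aᶜ) ≤ cl (a ⊓ o) ⊓ (a ⊓ o)ᶜ := by
      refine le_inf ?_ ?_
      · rw [← inf_assoc, inf_comm a o]
        exact inf_le_left.trans (inf_cl_le hoo a)
      · exact inf_le_right.trans (inf_le_right.trans (compl_le_compl inf_le_left))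
    exact (le_inf inf_le_right h1).trans ((inf_cl_le hoo _).trans (cl_mono h2))
  rw [ho, ← sdiff_eq, sdiff_eq_bot_iff] at hb
  exact hb

/-! ### The Heyting algebra of open elements -/

variable (M) in
/-- The open elements of an interior algebra, as a sublattice. -/
def opens : Sublattice M where
  carrier := {a | interiorOp a = a}
  supClosed' a ha b hb := le_antisymm (interiorOp_le _)
    (sup_le (le_interiorOp ha le_sup_left) (le_interiorOp hb le_sup_right))
  infClosed' a ha b hb := by
    change interiorOp (a ⊓ b) = a ⊓ b
    rw [interiorOp_inf, ha, hb]

theorem interiorOp_bot : interiorOp (⊥ : M) = ⊥ := le_bot_iff.1 (interiorOp_le _)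

variable (M) in
/-- The Heyting algebra of open elements of an interior algebra. -/
def Opens : Type u := opens M

noncomputable instance : HeytingAlgebra (Opens M) :=
  letI : DistribLattice (Opens M) := inferInstanceAs (DistribLattice (opens M))
  letI : BoundedOrder (Opens M) :=
    { top := ⟨⊤, interiorOp_top⟩
      bot := ⟨⊥, interiorOp_bot⟩
      le_top := fun a => (le_top : a.1 ≤ ⊤)
      bot_le := fun a => (bot_le : ⊥ ≤ a.1) }
  HeytingAlgebra.ofHImp (fun a b => ⟨interiorOp (a.1 ⇨ b.1), interiorOp_idem _⟩) fun a _ _ =>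
    ⟨fun h => (le_himp_iff (a := a.1)).1 (le_trans h (interiorOp_le _)),
      fun h => le_interiorOp a.2 ((le_himp_iff (a := a.1)).2 h)⟩

variable (M) in
/-- The inclusion of the open elements. -/
def Opens.val : BoundedLatticeHom (Opens M) M where
  toFun a := a.1
  map_sup' _ _ := rfl
  map_inf' _ _ := rfl
  map_top' := rfl
  map_bot' := rfl

/-- A lattice embedding of a Heyting algebra onto the open elements of an interior algebra. -/
structure IsOpensEmbedding {H : Type u} [HeytingAlgebra H] (e : BoundedLatticeHom H M) :
    Prop where
  injective : Function.Injective e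
  interiorOp_eq_iff : ∀ a, interiorOp a = a ↔ ∃ x, e x = a

theorem Opens.isOpensEmbedding_val : IsOpensEmbedding (Opens.val M) where
  injective _ _ h := Subtype.ext h
  interiorOp_eq_iff a := ⟨fun h => ⟨⟨a, h⟩, rfl⟩, fun ⟨x, hx⟩ => hx ▸ x.2⟩

/-! ### Restricting and extending homomorphisms -/

namespace IsOpensEmbedding

variable {N : Type u} [InteriorAlgebra N] {H K : Type u} [HeytingAlgebra H] [HeytingAlgebra K]
  {e : BoundedLatticeHom H M} {e' : BoundedLatticeHom K N}

theorem interiorOp_apply (he : IsOpensEmbedding e) (x : H) : interiorOp (e x) = e x :=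
  (he.interiorOp_eq_iff _).2 ⟨x, rfl⟩

theorem le_iff (he : IsOpensEmbedding e) {x y : H} : e x ≤ e y ↔ x ≤ y := by
  rw [← inf_eq_left, ← map_inf, he.injective.eq_iff, inf_eq_left]

theorem map_himp (he : IsOpensEmbedding e) (x y : H) : e (x ⇨ y) = interiorOp (e x ⇨ e y) := by
  obtain ⟨z, hz⟩ := (he.interiorOp_eq_iff _).1 (interiorOp_idem (e x ⇨ e y))
  refine le_antisymm (le_interiorOp (he.interiorOp_apply _) ?_) ?_
  · rw [le_himp_iff, ← map_inf, he.le_iff]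
    exact himp_inf_le
  · rw [← hz, he.le_iff, le_himp_iff, ← he.le_iff, map_inf, ← le_himp_iff, hz]
    exact interiorOp_le _

/-- Homomorphisms send open elements to open elements, and implication of open elements is the
interior of Boolean implication. -/
theorem exists_restrict (he : IsOpensEmbedding e) (he' : IsOpensEmbedding e')
    (g : ofInterior M →[interiorLanguage] ofInterior N) :
    ∃ f : ofHeyting H →[heytingLanguage] ofHeyting K, ∀ x : H, e' (f x) = g (e x) := by
  set G := BoundedLatticeHom.ofAlgHom g
  have hG := BoundedLatticeHom.ofAlgHom_interiorOp g
  have key : ∀ x, ∃ y, e' y = G (e x) := fun x =>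
    (he'.interiorOp_eq_iff _).1 (by rw [← hG, he.interiorOp_apply])
  choose f hf using key
  refine ⟨HeytingHom.toAlgHom
    { toFun := f
      map_sup' := fun a b => he'.injective (by simp only [hf, map_sup])
      map_inf' := fun a b => he'.injective (by simp only [hf, map_inf])
      map_bot' := he'.injective (by simp only [hf, map_bot])
      map_himp' := fun a b => he'.injective (by
        rw [he'.map_himp, hf, hf, hf, he.map_himp, hG, himp_eq, himp_eq, map_sup, map_compl']) },
    hf⟩

theorem hom_ext (hgen : BooleanSubalgebra.closure (Set.range e) = ⊤)
    {g g' : ofInterior M →[interiorLanguage] ofInterior N} (h : ∀ x, g (e x) = g' (e x))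
    (a : M) : g a = g' a := by
  change BoundedLatticeHom.ofAlgHom g a = BoundedLatticeHom.ofAlgHom g' a
  have ha : a ∈ BooleanSubalgebra.closure (Set.range e) := hgen ▸ BooleanSubalgebra.mem_top
  induction ha using BooleanSubalgebra.closure_bot_sup_induction with
  | mem a ha => obtain ⟨x, rfl⟩ := ha; exact h x
  | bot => simp only [map_bot]
  | sup a _ b _ ha hb => simp only [map_sup, ha, hb]
  | compl a _ ha => simp only [map_compl', ha]

/-- The interior of any preimage of an open element is an open preimage. -/
theorem surjective_restrict (he : IsOpensEmbedding e) (he' : IsOpensEmbedding e')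
    {g : ofInterior M →[interiorLanguage] ofInterior N} (hg : Function.Surjective g)
    {f : ofHeyting H →[heytingLanguage] ofHeyting K} (hfg : ∀ x : H, e' (f x) = g (e x)) :
    Function.Surjective f := by
  intro (y : K)
  obtain ⟨a, ha⟩ : ∃ a : M, BoundedLatticeHom.ofAlgHom g a = e' y := hg _
  obtain ⟨x, hx⟩ := (he.interiorOp_eq_iff _).1 (interiorOp_idem a)
  refine ⟨x, he'.injective ?_⟩
  refine (hfg x).trans ?_
  change BoundedLatticeHom.ofAlgHom g (e x) = e' y
  rw [hx, BoundedLatticeHom.ofAlgHom_interiorOp, ha, he'.interiorOp_apply]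

theorem surjective_of_forall_mem_range (hgen : BooleanSubalgebra.closure (Set.range e') = ⊤)
    {g : ofInterior M →[interiorLanguage] ofInterior N} (h : ∀ x, ∃ a, g a = e' x) :
    Function.Surjective g := by
  intro (b : N)
  change ∃ a, BoundedLatticeHom.ofAlgHom g a = b
  have hb : b ∈ BooleanSubalgebra.closure (Set.range e') := hgen ▸ BooleanSubalgebra.mem_top
  induction hb using BooleanSubalgebra.closure_bot_sup_induction with
  | mem b hb => obtain ⟨x, rfl⟩ := hb; exact h x
  | bot => exact ⟨⊥, map_bot _⟩
  | sup a _ b _ ha hb =>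
    obtain ⟨a, rfl⟩ := ha
    obtain ⟨b, rfl⟩ := hb
    exact ⟨a ⊔ b, (BoundedLatticeHom.ofAlgHom g).map_sup' a b⟩
  | compl a _ ha =>
    obtain ⟨a, rfl⟩ := ha
    exact ⟨aᶜ, map_compl' (BoundedLatticeHom.ofAlgHom g) a⟩

/-- The graph of the extension is the Boolean subalgebra `G` of `M × N` generated by the pairs `(e
x, e' (f x))`. It remains to see that `G` is functional, total and closed under the interior
operators. -/
theorem exists_lift (he : IsOpensEmbedding e)
    (hgen : BooleanSubalgebra.closure (Set.range e) = ⊤) (he' : IsOpensEmbedding e')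
    (f : ofHeyting H →[heytingLanguage] ofHeyting K) :
    ∃ g : ofInterior M →[interiorLanguage] ofInterior N, ∀ x : H, g (e x) = e' (f x) := by
  set F := HeytingHom.ofAlgHom f
  let S : Set (M × N) := Set.range fun x => (e x, e' (F x))
  let G : BooleanSubalgebra (M × N) := BooleanSubalgebra.closure S
  have hS : IsSublattice S :=
    ⟨by rintro _ ⟨a, rfl⟩ _ ⟨b, rfl⟩; exact ⟨a ⊔ b, by simp⟩,
     by rintro _ ⟨a, rfl⟩ _ ⟨b, rfl⟩; exact ⟨a ⊓ b, by simp⟩⟩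
  have hbot : ⊥ ∈ S := ⟨⊥, by simp; rfl⟩
  have htop : ⊤ ∈ S := ⟨⊤, by simp; rfl⟩
  -- Since `S` is a bounded sublattice, elements of `G` are joins of differences, and a difference
  -- vanishes exactly when an inequality holds, which `F` preserves.
  have hker : ∀ z ∈ G, z.1 = ⊥ → z.2 = ⊥ := by
    intro z hz
    induction z, hz using BooleanSubalgebra.closure_sdiff_sup_induction hS hbot htop with
    | sdiff x hx y hy =>
      obtain ⟨a, rfl⟩ := hx
      obtain ⟨b, rfl⟩ := hy
      change e a \ e b = ⊥ → e' (F a) \ e' (F b) = ⊥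
      rw [sdiff_eq_bot_iff, sdiff_eq_bot_iff, he.le_iff, he'.le_iff]
      exact fun h => OrderHomClass.mono F h
    | sup x _ y _ hx hy =>
      simp only [Prod.fst_sup, Prod.snd_sup, sup_eq_bot_iff]
      exact fun h => ⟨hx h.1, hy h.2⟩
  have huniq : ∀ {x y y'}, (x, y) ∈ G → (x, y') ∈ G → y = y' := by
    intro x y y' h h'
    refine le_antisymm ?_ ?_
    · exact sdiff_eq_bot_iff.1 (hker _ (BooleanSubalgebra.sdiff_mem h h') sdiff_self)
    · exact sdiff_eq_bot_iff.1 (hker _ (BooleanSubalgebra.sdiff_mem h' h) sdiff_self)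
  have htotal : ∀ x, ∃ y, (x, y) ∈ G := by
    intro x
    have hx : x ∈ BooleanSubalgebra.closure (Set.range e) := hgen ▸ BooleanSubalgebra.mem_top
    induction hx using BooleanSubalgebra.closure_bot_sup_induction with
    | mem x hx =>
      obtain ⟨a, rfl⟩ := hx
      exact ⟨_, BooleanSubalgebra.subset_closure ⟨a, rfl⟩⟩
    | bot => exact ⟨⊥, BooleanSubalgebra.bot_mem⟩
    | sup x _ y _ hx hy =>
      obtain ⟨x', hx'⟩ := hx
      obtain ⟨y', hy'⟩ := hy
      exact ⟨_, BooleanSubalgebra.sup_mem hx' hy'⟩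
    | compl x _ hx =>
      obtain ⟨x', hx'⟩ := hx
      exact ⟨_, BooleanSubalgebra.compl_mem hx'⟩
  -- Complements turn joins of differences into meets of Boolean implications; interior distributes
  -- over meets and sends each implication into `S`.
  have hint' : ∀ z ∈ G, (interiorOp z.1ᶜ, interiorOp z.2ᶜ) ∈ G := by
    intro z hz
    induction z, hz using BooleanSubalgebra.closure_sdiff_sup_induction hS hbot htop with
    | sdiff x hx y hy =>
      obtain ⟨a, rfl⟩ := hx
      obtain ⟨b, rfl⟩ := hy
      refine BooleanSubalgebra.subset_closure ⟨a ⇨ b, ?_⟩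
      change (e (a ⇨ b), e' (F (a ⇨ b))) =
        (interiorOp (e a \ e b)ᶜ, interiorOp (e' (F a) \ e' (F b))ᶜ)
      rw [show F (a ⇨ b) = F a ⇨ F b from F.map_himp' a b, he.map_himp, he'.map_himp,
        compl_sdiff, compl_sdiff]
    | sup x _ y _ hx hy =>
      simp only [Prod.fst_sup, Prod.snd_sup, compl_sup, interiorOp_inf]
      exact BooleanSubalgebra.inf_mem hx hy
  have hint : ∀ {x y}, (x, y) ∈ G → (interiorOp x, interiorOp y) ∈ G := by
    intro x y h
    simpa using hint' _ (BooleanSubalgebra.compl_mem h)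
  choose g hg using htotal
  refine ⟨BoundedLatticeHom.toAlgHom
    { toFun := g
      map_sup' := fun a b => huniq (hg _) (BooleanSubalgebra.sup_mem (hg a) (hg b))
      map_inf' := fun a b => huniq (hg _) (BooleanSubalgebra.inf_mem (hg a) (hg b))
      map_top' := huniq (hg _) BooleanSubalgebra.top_mem
      map_bot' := huniq (hg _) BooleanSubalgebra.bot_mem } fun a => huniq (hg _) (hint (hg a)),
    fun x => huniq (hg _) (BooleanSubalgebra.subset_closure ⟨x, rfl⟩)⟩

/-- Interior algebras generated by their open elements are Grzegorczyk algebras. -/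
theorem isGrz (he : IsOpensEmbedding e)
    (hgen : BooleanSubalgebra.closure (Set.range e) = ⊤) : IsGrz M := by
  -- Every `a` is locally decided: some open `o` meets `b`, and within `o` the closure of `b` lies
  -- wholly inside or wholly outside `a`. This holds for open `a` and is inherited by Boolean
  -- combinations.
  have key : ∀ a b : M, b ≠ ⊥ → ∃ o, interiorOp o = o ∧ o ⊓ b ≠ ⊥ ∧
      (o ⊓ cl b ≤ a ∨ o ⊓ cl b ≤ aᶜ) := by
    intro a
    have ha : a ∈ BooleanSubalgebra.closure (Set.range e) := hgen ▸ BooleanSubalgebra.mem_top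
    induction ha using BooleanSubalgebra.closure_bot_sup_induction with
    | mem a ha =>
      obtain ⟨x, rfl⟩ := ha
      intro b hb
      by_cases h : e x ⊓ b = ⊥
      · refine ⟨⊤, interiorOp_top, by rwa [top_inf_eq], Or.inr ?_⟩
        rw [top_inf_eq]
        refine cl_le (by rw [compl_compl, he.interiorOp_apply]) ?_
        rwa [le_compl_iff_disjoint_left, disjoint_iff]
      · exact ⟨e x, he.interiorOp_apply x, h, Or.inl inf_le_left⟩
    | bot => exact fun b hb => ⟨⊤, interiorOp_top, by rwa [top_inf_eq], Or.inr (by simp)⟩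
    | sup a _ a' _ ha ha' =>
      intro b hb
      obtain ⟨o, ho, hob, h⟩ := ha b hb
      -- The second decision is made for `o ⊓ b`, so that `o' ⊓ o` still meets `b`.
      obtain ⟨o', ho', hob', h'⟩ := ha' _ hob
      have hle : o' ⊓ o ⊓ cl b ≤ o' ⊓ cl (o ⊓ b) := by
        rw [inf_assoc]
        exact inf_le_inf_left _ (inf_cl_le ho b)
      have hle' : o' ⊓ o ⊓ cl b ≤ o ⊓ cl b := inf_le_inf_right _ inf_le_right
      refine ⟨o' ⊓ o, by rw [interiorOp_inf, ho, ho'], by rwa [inf_assoc], ?_⟩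
      rcases h with h | h
      · exact Or.inl ((hle'.trans h).trans le_sup_left)
      · rcases h' with h' | h'
        · exact Or.inl ((hle.trans h').trans le_sup_right)
        · rw [compl_sup]
          exact Or.inr (le_inf (hle'.trans h) (hle.trans h'))
    | compl a _ ha =>
      intro b hb
      obtain ⟨o, ho, hob, h⟩ := ha b hb
      exact ⟨o, ho, hob, by rwa [compl_compl, or_comm]⟩
  refine isGrz_of_forall_eq_bot fun b hle => ?_
  by_contra hb
  -- Let `b` decide itself. If `o ⊓ cl b ≤ b`, then `o` misses `cl b ⊓ bᶜ`, hence its closure and so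
  -- `b`; otherwise `o ⊓ b ≤ bᶜ`.
  obtain ⟨o, ho, hob, h | h⟩ := key b b hb
  · apply hob
    have h1 : o ⊓ (cl b ⊓ bᶜ) = ⊥ := by
      rw [← inf_assoc, ← sdiff_eq, sdiff_eq_bot_iff]
      exact h
    have h2 := (inf_le_inf_left o hle).trans (inf_cl_le ho _)
    rwa [h1, cl_bot, le_bot_iff] at h2
  · apply hob
    have h1 : o ⊓ b ≤ bᶜ := (inf_le_inf_left o (le_cl b)).trans h
    rw [← le_bot_iff, ← inf_compl_self b]
    exact le_inf inf_le_right h1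

end IsOpensEmbedding

/-- Finite Grzegorczyk algebras are generated by their open elements. -/
theorem IsGrz.closure_range_val [Finite M] (h : IsGrz M) :
    BooleanSubalgebra.closure (Set.range (Opens.val M)) = ⊤ := by
  set S := BooleanSubalgebra.closure (Set.range (Opens.val M))
  have hS : ∀ a : M, interiorOp a = a → a ∈ S := fun a ha =>
    BooleanSubalgebra.subset_closure ⟨⟨a, ha⟩, rfl⟩
  have hS' : ∀ a : M, interiorOp aᶜ = aᶜ → a ∈ S := fun a ha =>
    compl_compl a ▸ BooleanSubalgebra.compl_mem (hS _ ha)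
  -- Well-founded induction on the closed element `c`. If `c₂ < c`, then `c ⊓ a` is the join of `c ⊓
  -- c₁ᶜ` and `c₂ ⊓ a`, the latter covered by induction. If `c₂ = c`, both `c ⊓ a` and `c ⊓ aᶜ` have
  -- closure `c`, and the Grzegorczyk law for `c ⊓ a` forces `c ⊓ a = ⊥`.
  have key : ∀ a c : M, interiorOp cᶜ = cᶜ → c ⊓ a ∈ S := by
    intro a c
    induction c using WellFoundedLT.induction with
    | ind c ih =>
      intro hc
      set c₁ := cl (c ⊓ aᶜ) with hc₁
      set c₂ := cl (c₁ ⊓ a) with hc₂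
      have h₁ : c₁ ≤ c := cl_le hc inf_le_left
      have h₂ : c₂ ≤ c₁ := cl_le (interiorOp_compl_cl _) inf_le_left
      rcases (h₂.trans h₁).lt_or_eq with hlt | heq
      · have h₃ : c₁ ⊓ a = c₂ ⊓ a :=
          le_antisymm (le_inf (le_cl _) inf_le_right) (inf_le_inf_right _ h₂)
        have h₄ : c ⊓ a = c ⊓ c₁ᶜ ⊔ c₂ ⊓ a := by
          rw [← h₃]
          refine le_antisymm ?_ (sup_le (le_inf inf_le_left ?_) (inf_le_inf_right _ h₁))
          · calc c ⊓ a = c ⊓ a ⊓ (c₁ᶜ ⊔ c₁) := by rw [compl_sup_eq_top, inf_top_eq]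
              _ = c ⊓ a ⊓ c₁ᶜ ⊔ c ⊓ a ⊓ c₁ := inf_sup_left _ _ _
              _ ≤ _ := sup_le_sup (inf_le_inf_right _ inf_le_left)
                (le_inf inf_le_right (inf_le_left.trans inf_le_right))
          · have : c ⊓ aᶜ ≤ c₁ := le_cl _
            rw [← compl_compl a, le_compl_iff_disjoint_right, disjoint_iff, inf_right_comm,
              ← sdiff_eq, sdiff_eq_bot_iff]
            exact this
        rw [h₄]
        exact BooleanSubalgebra.sup_mem (BooleanSubalgebra.inf_mem (hS' _ hc)
          (hS _ (interiorOp_compl_cl _))) (ih _ hlt (interiorOp_compl_cl _))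
      · have h₃ : c₁ = c := le_antisymm h₁ (heq.symm.trans_le h₂)
        have h₄ : cl (c ⊓ a) = c := by rw [← h₃, ← hc₂, heq, h₃]
        have h₅ := h (c ⊓ a)
        have h₆ : c ⊓ (c ⊓ a)ᶜ = c ⊓ aᶜ := by
          rw [compl_inf, inf_sup_left, inf_compl_self, bot_sup_eq]
        rw [h₄, h₆, ← hc₁, h₃, inf_right_comm, inf_compl_self, bot_inf_eq, cl_bot,
          le_bot_iff] at h₅
        rw [h₅]
        exact BooleanSubalgebra.bot_mem
  rw [eq_top_iff]
  intro a _
  simpa using key a ⊤ (by rw [compl_top, interiorOp_bot])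

end InteriorAlgebra

/-! ### The equational class of Grzegorczyk algebras -/

section GrzClass

open FirstOrder.Language InteriorAlgebra

/-- The equations valid in all Grzegorczyk algebras. -/
def grzEquations : Set (interiorLanguage.Term ℕ × interiorLanguage.Term ℕ) :=
  {p | ∀ (M : Type u) [InteriorAlgebra M], IsGrz M → ∀ v : ℕ → ofInterior M,
    p.1.realize v = p.2.realize v}

/-! ### Terms of interior algebras -/

namespace InteriorTerm

/-- The operation `bot` on terms. -/
def botT : interiorLanguage.Term ℕ :=
  Term.func InteriorOp.bot ![]

/-- The operation `top` on terms. -/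
def topT : interiorLanguage.Term ℕ :=
  Term.func InteriorOp.top ![]

/-- The operation `sup` on terms. -/
def supT (s t : interiorLanguage.Term ℕ) : interiorLanguage.Term ℕ :=
  Term.func InteriorOp.sup ![s, t]

/-- The operation `inf` on terms. -/
def infT (s t : interiorLanguage.Term ℕ) : interiorLanguage.Term ℕ :=
  Term.func InteriorOp.inf ![s, t]

/-- The operation `compl` on terms. -/
def complT (t : interiorLanguage.Term ℕ) : interiorLanguage.Term ℕ :=
  Term.func InteriorOp.compl ![t]

/-- The operation `int` on terms. -/
def intT (t : interiorLanguage.Term ℕ) : interiorLanguage.Term ℕ :=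
  Term.func InteriorOp.int ![t]

variable {C : Alg.{u} interiorLanguage} (v : ℕ → C)

theorem realize_botT :
    botT.realize v =
      Structure.funMap (L := interiorLanguage) InteriorOp.bot ![] :=
  congrArg (Structure.funMap (L := interiorLanguage) InteriorOp.bot) (Subsingleton.elim _ _)

theorem realize_topT :
    topT.realize v =
      Structure.funMap (L := interiorLanguage) InteriorOp.top ![] :=
  congrArg (Structure.funMap (L := interiorLanguage) InteriorOp.top) (Subsingleton.elim _ _)

theorem realize_supT (s t : interiorLanguage.Term ℕ) :
    (supT s t).realize v =
      Structure.funMap (L := interiorLanguage) InteriorOp.sup ![s.realize v, t.realize v] :=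
  congrArg (Structure.funMap (L := interiorLanguage) InteriorOp.sup)
    (funext fun i => by fin_cases i <;> rfl)

theorem realize_infT (s t : interiorLanguage.Term ℕ) :
    (infT s t).realize v =
      Structure.funMap (L := interiorLanguage) InteriorOp.inf ![s.realize v, t.realize v] :=
  congrArg (Structure.funMap (L := interiorLanguage) InteriorOp.inf)
    (funext fun i => by fin_cases i <;> rfl)

theorem realize_complT (t : interiorLanguage.Term ℕ) :
    (complT t).realize v =
      Structure.funMap (L := interiorLanguage) InteriorOp.compl ![t.realize v] :=
  congrArg (Structure.funMap (L := interiorLanguage) InteriorOp.compl)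
    (funext fun i => by fin_cases i; rfl)

theorem realize_intT (t : interiorLanguage.Term ℕ) :
    (intT t).realize v =
      Structure.funMap (L := interiorLanguage) InteriorOp.int ![t.realize v] :=
  congrArg (Structure.funMap (L := interiorLanguage) InteriorOp.int)
    (funext fun i => by fin_cases i; rfl)

end InteriorTerm

theorem ofInterior_mem_equationalClass {M : Type u} [InteriorAlgebra M] (h : IsGrz M) :
    ofInterior M ∈ equationalClass grzEquations.{u} :=
  fun _ hp v => hp M h v

-- The Boolean, interior and Grzegorczyk axioms are all equations, with `a ≤ b` read as `a ⊔ b = b`.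
-- Holding in all Grzegorczyk algebras, they hold in `C` and give its bare operations the required
-- structure.
open InteriorTerm in
theorem exists_eq_ofInterior {C : Alg.{u} interiorLanguage}
    (hC : C ∈ equationalClass grzEquations.{u}) :
    ∃ (M : Type u) (_ : InteriorAlgebra M), IsGrz M ∧ C = ofInterior M := by
  let bo : C := Structure.funMap (L := interiorLanguage) InteriorOp.bot ![]
  let tp : C := Structure.funMap (L := interiorLanguage) InteriorOp.top ![]
  let jn (a b : C) : C := Structure.funMap (L := interiorLanguage) InteriorOp.sup ![a, b]
  let mt (a b : C) : C := Structure.funMap (L := interiorLanguage) InteriorOp.inf ![a, b]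
  let cp (a : C) : C := Structure.funMap (L := interiorLanguage) InteriorOp.compl ![a]
  let bx (a : C) : C := Structure.funMap (L := interiorLanguage) InteriorOp.int ![a]
  let val (a b c : C) (n : ℕ) : C := match n with
    | 0 => a
    | 1 => b
    | _ => c
  let x : interiorLanguage.Term ℕ := Term.var 0
  let y : interiorLanguage.Term ℕ := Term.var 1
  let z : interiorLanguage.Term ℕ := Term.var 2
  have law : ∀ (s t : interiorLanguage.Term ℕ),
      (∀ (M : Type u) [InteriorAlgebra M], IsGrz M → ∀ v : ℕ → ofInterior M,
        s.realize v = t.realize v) → ∀ a b c : C, s.realize (val a b c) = t.realize (val a b c) :=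
    fun s t h a b c => hC (s, t) h (val a b c)
  have sup_comm' : ∀ a b : C, jn a b = jn b a := by
    intro a b
    have h := law (supT x y) (supT y x)
      (fun M _ _ v => sup_comm (α := M) (v 0) (v 1)) a b a
    simp only [realize_supT] at h
    exact h
  have sup_assoc' : ∀ a b c : C, jn (jn a b) c = jn a (jn b c) := by
    intro a b c
    have h := law (supT (supT x y) z) (supT x (supT y z))
      (fun M _ _ v => sup_assoc (α := M) (v 0) (v 1) (v 2)) a b c
    simp only [realize_supT] at h
    exact h
  have inf_comm' : ∀ a b : C, mt a b = mt b a := by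
    intro a b
    have h := law (infT x y) (infT y x)
      (fun M _ _ v => inf_comm (α := M) (v 0) (v 1)) a b a
    simp only [realize_infT] at h
    exact h
  have inf_assoc' : ∀ a b c : C, mt (mt a b) c = mt a (mt b c) := by
    intro a b c
    have h := law (infT (infT x y) z) (infT x (infT y z))
      (fun M _ _ v => inf_assoc (α := M) (v 0) (v 1) (v 2)) a b c
    simp only [realize_infT] at h
    exact h
  have sup_inf' : ∀ a b : C, jn a (mt a b) = a := by
    intro a b
    have h := law (supT x (infT x y)) x
      (fun M _ _ v => sup_inf_self (α := M) (a := v 0) (b := v 1)) a b a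
    simp only [realize_supT, realize_infT] at h
    exact h
  have inf_sup' : ∀ a b : C, mt a (jn a b) = a := by
    intro a b
    have h := law (infT x (supT x y)) x
      (fun M _ _ v => inf_sup_self (α := M) (a := v 0) (b := v 1)) a b a
    simp only [realize_supT, realize_infT] at h
    exact h
  have distrib' : ∀ a b c : C, mt a (jn b c) = jn (mt a b) (mt a c) := by
    intro a b c
    have h := law (infT x (supT y z)) (supT (infT x y) (infT x z))
      (fun M _ _ v => inf_sup_left (α := M) (v 0) (v 1) (v 2)) a b c
    simp only [realize_supT, realize_infT] at h
    exact h
  have inf_compl' : ∀ a : C, mt a (cp a) = bo := by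
    intro a
    have h := law (infT x (complT x)) botT
      (fun M _ _ v => inf_compl_self (α := M) (v 0)) a a a
    simp only [realize_botT, realize_infT, realize_complT] at h
    exact h
  have sup_compl' : ∀ a : C, jn a (cp a) = tp := by
    intro a
    have h := law (supT x (complT x)) topT
      (fun M _ _ v => sup_compl_eq_top (α := M) (x := v 0)) a a a
    simp only [realize_topT, realize_supT, realize_complT] at h
    exact h
  have bot_sup' : ∀ a : C, jn bo a = a := by
    intro a
    have h := law (supT botT x) x
      (fun M _ _ v => bot_sup_eq (α := M) (v 0)) a a a
    simp only [realize_botT, realize_supT] at h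
    exact h
  have sup_top' : ∀ a : C, jn a tp = tp := by
    intro a
    have h := law (supT x topT) topT
      (fun M _ _ v => sup_top_eq (α := M) (v 0)) a a a
    simp only [realize_topT, realize_supT] at h
    exact h
  have int_top' : bx tp = tp := by
    have h := law (intT topT) topT
      (fun M _ _ v => interiorOp_top (B := M)) bo bo bo
    simp only [realize_topT, realize_intT] at h
    exact h
  have int_inf' : ∀ a b : C, bx (mt a b) = mt (bx a) (bx b) := by
    intro a b
    have h := law (intT (infT x y)) (infT (intT x) (intT y))
      (fun M _ _ v => interiorOp_inf (B := M) (v 0) (v 1)) a b a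
    simp only [realize_infT, realize_intT] at h
    exact h
  have int_le' : ∀ a : C, jn (bx a) a = a := by
    intro a
    have h := law (supT (intT x) x) x
      (fun M _ _ v => (sup_eq_right (α := M)).2 (interiorOp_le (B := M) (v 0))) a a a
    simp only [realize_supT, realize_intT] at h
    exact h
  have int_idem' : ∀ a : C, bx (bx a) = bx a := by
    intro a
    have h := law (intT (intT x)) (intT x)
      (fun M _ _ v => interiorOp_idem (B := M) (v 0)) a a a
    simp only [realize_intT] at h
    exact h
  let cT (t : interiorLanguage.Term ℕ) := complT (intT (complT t))
  let c (a : C) := cp (bx (cp a))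
  let g := cT (infT x (complT (cT (infT (cT x) (complT x)))))
  have grz' : ∀ a : C, jn a (c (mt a (cp (c (mt (c a) (cp a)))))) =
      c (mt a (cp (c (mt (c a) (cp a))))) := by
    intro a
    have h := law (supT x g) g
      (fun M _ hM v => (sup_eq_right (α := M)).2 (hM (v 0))) a a a
    simp only [g, cT, realize_supT, realize_infT, realize_complT, realize_intT] at h
    exact h
  let _ : Max C := ⟨jn⟩
  let _ : Min C := ⟨mt⟩
  let l : Lattice C := Lattice.mk' sup_comm' sup_assoc' inf_comm' inf_assoc' sup_inf' inf_sup'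
  let d : DistribLattice C := DistribLattice.ofInfSupLe fun a b c => (distrib' a b c).le
  let B : BooleanAlgebra C :=
    { d with
      compl := cp
      top := tp
      bot := bo
      sdiff := fun a b => mt a (cp b)
      himp := fun a b => jn b (cp a)
      sdiff_eq := fun _ _ => rfl
      himp_eq := fun _ _ => rfl
      inf_compl_le_bot := fun a => (inf_compl' a).le
      top_le_sup_compl := fun a => (sup_compl' a).ge
      le_top := fun a => sup_eq_right.1 (sup_top' a)
      bot_le := fun a => sup_eq_right.1 (bot_sup' a) }
  let I : InteriorAlgebra C :=
    { B with
      interiorOp := bx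
      interiorOp_top := int_top'
      interiorOp_inf := int_inf'
      interiorOp_le := fun a => sup_eq_right.1 (int_le' a)
      interiorOp_idem := int_idem' }
  refine ⟨C, I, fun a => sup_eq_right.1 (grz' a), ?_⟩
  obtain ⟨α, str⟩ := C
  unfold ofInterior
  congr 1
  ext n o w
  · cases o
    · exact congrArg _ (Subsingleton.elim _ _)
    · exact congrArg _ (Subsingleton.elim _ _)
    -- Only the argument tuples differ: `w` and the vector listing its entries have the same list of
    -- values.
    · exact congrArg _ (List.ofFn_injective rfl)
    · exact congrArg _ (List.ofFn_injective rfl)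
    · exact congrArg _ (List.ofFn_injective rfl)
    · exact congrArg _ (List.ofFn_injective rfl)
  · exact isEmptyElim (α := interiorLanguage.Relations n) o

end GrzClass

/-! ### The variety `ρ*(V)` -/

section RhoStar

open InteriorAlgebra

/-! ### Open elements of `𝓑(A)` -/

namespace FreeBooleanExtension

variable (A : Type u) [HeytingAlgebra A]

/-- The embedding `incl` as a bounded lattice homomorphism. -/
def inclHom : BoundedLatticeHom A (FreeBooleanExtension A) where
  toFun := incl
  map_sup' := incl_sup
  map_inf' := incl_inf
  map_top' := incl_top
  map_bot' := incl_bot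

theorem isOpensEmbedding_inclHom : IsOpensEmbedding (inclHom A) where
  injective _ _ h := le_antisymm (incl_le_iff.1 h.le) (incl_le_iff.1 h.ge)
  interiorOp_eq_iff a := by
    constructor
    · intro h
      obtain ⟨x, hx⟩ := exists_int_eq a
      exact ⟨x, hx.symm.trans h⟩
    · rintro ⟨x, rfl⟩
      exact int_incl x

theorem closure_range_inclHom : BooleanSubalgebra.closure (Set.range (inclHom A)) = ⊤ := by
  rw [eq_top_iff]
  intro a _
  obtain ⟨s, rfl⟩ := exists_clauses a
  have h : ∀ x : A, incl x ∈ BooleanSubalgebra.closure (Set.range (inclHom A)) :=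
    fun x => BooleanSubalgebra.subset_closure ⟨x, rfl⟩
  exact s.inf_mem _ BooleanSubalgebra.top_mem (fun _ hx _ hy => BooleanSubalgebra.inf_mem hx hy)
    _ fun p _ => BooleanSubalgebra.sup_mem (BooleanSubalgebra.compl_mem (h _)) (h _)

instance [Finite A] : Finite (FreeBooleanExtension A) :=
  have : Finite {I : Order.Ideal A // I.IsPrime} :=
    Finite.of_injective (fun I => (I.1 : Set A)) fun _ _ h => Subtype.ext (SetLike.coe_injective h)
  inferInstanceAs (Finite (BooleanSubalgebra.closure (Set.range (stoneMap A))))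

end FreeBooleanExtension

open FreeBooleanExtension

variable {V : Set (Alg.{u} heytingLanguage)}

theorem IsVariety.ofHeyting_mem_of_surjective (hV : IsVariety V) {M N : Type u}
    [InteriorAlgebra M] [InteriorAlgebra N] (f : ofInterior M →[interiorLanguage] ofInterior N)
    (hf : Function.Surjective f) {H K : Type u} [HeytingAlgebra H] [HeytingAlgebra K]
    {e : BoundedLatticeHom H M} {e' : BoundedLatticeHom K N} (he : IsOpensEmbedding e)
    (he' : IsOpensEmbedding e') (hH : ofHeyting H ∈ V) : ofHeyting K ∈ V := by
  obtain ⟨g, hg⟩ := he.exists_restrict he' f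
  exact hV.image_mem _ _ g hH (he.surjective_restrict he' hf hg)

/-- `ρ*(V)` consists of Grzegorczyk algebras whose open elements form an algebra of `V`. -/
theorem exists_eq_ofInterior_of_mem_rhoStar (hV : IsVariety V)
    {C : Alg.{u} interiorLanguage} (hC : C ∈ rhoStar V) :
    ∃ (M : Type u) (_ : InteriorAlgebra M),
      C = ofInterior M ∧ IsGrz M ∧ ofHeyting (Opens M) ∈ V := by
  -- The described class is itself a variety containing every `𝓑(A)`, so it contains the generated
  -- one.
  refine hC {C | ∃ (M : Type u) (_ : InteriorAlgebra M),
      C = ofInterior M ∧ IsGrz M ∧ ofHeyting (Opens M) ∈ V}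
    (isVariety_of_jointly_injective ?_ ?_) ?_
  · rintro _ B f ⟨M, _, rfl, hM, hMV⟩ hf
    obtain ⟨N, _, hN, rfl⟩ := exists_eq_ofInterior
      (mem_equationalClass_of_surjective f hf (ofInterior_mem_equationalClass hM))
    exact ⟨N, _, rfl, hN, hV.ofHeyting_mem_of_surjective f hf Opens.isOpensEmbedding_val
      Opens.isOpensEmbedding_val hMV⟩
  · intro A I B f hf hB
    choose M _ hBM hM hMV using hB
    obtain rfl : B = fun i => ofInterior (M i) := funext hBM
    obtain ⟨N, _, hN, rfl⟩ := exists_eq_ofInterior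
      (mem_equationalClass_of_jointly_injective f hf fun i =>
        ofInterior_mem_equationalClass (hM i))
    refine ⟨N, _, rfl, hN, ?_⟩
    choose g hg using fun i => Opens.isOpensEmbedding_val.exists_restrict
      Opens.isOpensEmbedding_val (f i)
    refine hV.mem_of_jointly_injective g (fun x y h => ?_) hMV
    refine Opens.isOpensEmbedding_val.injective (hf _ _ fun i => ?_)
    exact (hg i x).symm.trans ((congrArg (Opens.val (M i)) (h i)).trans (hg i y))
  · rintro _ ⟨A, _, hA, rfl⟩
    refine ⟨_, _, rfl, (isOpensEmbedding_inclHom A).isGrz (closure_range_inclHom A), ?_⟩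
    -- The identity of `𝓑(A)` restricts to a surjection from `A` onto the open elements of `𝓑(A)`.
    exact hV.ofHeyting_mem_of_surjective (FirstOrder.Language.Hom.id _ _)
      Function.surjective_id (isOpensEmbedding_inclHom A) Opens.isOpensEmbedding_val hA

theorem ofInterior_freeBooleanExtension_mem {A : Type u} [HeytingAlgebra A]
    (hA : ofHeyting A ∈ V) : ofInterior (FreeBooleanExtension A) ∈ rhoStar V :=
  fun _ _ hW => hW ⟨A, _, hA, rfl⟩

/-- Finitely presented algebras of `V` are finite if `ρ*(V)` is locally finite. -/
theorem finite_of_isFinitelyPresentedIn (hfin : IsLocallyFiniteClass (rhoStar V)) {A : Type u}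
    [HeytingAlgebra A] (hA : IsFinitelyPresentedIn V (ofHeyting A)) : Finite A := by
  obtain ⟨n, a, ha⟩ := hA.exists_closure_eq_top
  let B := ofInterior (FreeBooleanExtension A)
  let i : A → B := incl
  let S : interiorLanguage.Substructure B :=
    FirstOrder.Language.Substructure.closure _ (Set.range fun k => i (a k))
  have hS : Finite S := hfin B (ofInterior_freeBooleanExtension_mem hA.1) S
    (FirstOrder.Language.Substructure.fg_closure (Set.finite_range _))
  -- The part of `A` lying in the finite algebra `S` is a Heyting subalgebra, as `x ⇨ y` is the
  -- interior of `y ⊔ xᶜ`. It contains the generators, so it is all of `A`.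
  let T : heytingLanguage.Substructure (ofHeyting A) :=
    { carrier := {x | i x ∈ S}
      fun_mem := by
        have sup_mem : ∀ {x y : FreeBooleanExtension A}, x ∈ S → y ∈ S → (x ⊔ y) ∈ S :=
          fun {x y} hx hy => S.fun_mem InteriorOp.sup ![x, y] (by
            intro k; fin_cases k; exacts [hx, hy])
        have inf_mem : ∀ {x y : FreeBooleanExtension A}, x ∈ S → y ∈ S → (x ⊓ y) ∈ S :=
          fun {x y} hx hy => S.fun_mem InteriorOp.inf ![x, y] (by
            intro k; fin_cases k; exacts [hx, hy])
        have compl_mem : ∀ {x : FreeBooleanExtension A}, x ∈ S → xᶜ ∈ S :=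
          fun {x} hx => S.fun_mem InteriorOp.compl ![x] (by intro k; fin_cases k; exact hx)
        have int_mem : ∀ {x : FreeBooleanExtension A}, x ∈ S → interiorOp x ∈ S :=
          fun {x} hx => S.fun_mem InteriorOp.int ![x] (by intro k; fin_cases k; exact hx)
        have bot_mem : (⊥ : FreeBooleanExtension A) ∈ S :=
          S.fun_mem InteriorOp.bot ![] (fun k => k.elim0)
        have top_mem : (⊤ : FreeBooleanExtension A) ∈ S :=
          S.fun_mem InteriorOp.top ![] (fun k => k.elim0)
        have mem_of_eq : ∀ {x y : FreeBooleanExtension A}, x = y → y ∈ S → x ∈ S :=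
          fun h hy => h ▸ hy
        rintro _ (_ | _) x hx
        · exact mem_of_eq incl_bot bot_mem
        · exact mem_of_eq incl_top top_mem
        · exact mem_of_eq (incl_sup (A := A) (x 0) (x 1)) (sup_mem (hx 0) (hx 1))
        · exact mem_of_eq (incl_inf (A := A) (x 0) (x 1)) (inf_mem (hx 0) (hx 1))
        · have h := (isOpensEmbedding_inclHom A).map_himp (x 0) (x 1)
          rw [himp_eq] at h
          exact mem_of_eq h (int_mem (sup_mem (hx 1) (compl_mem (hx 0)))) }
  have hT : T = ⊤ := by
    rw [eq_top_iff, ← ha, FirstOrder.Language.Substructure.closure_le]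
    rintro _ ⟨k, rfl⟩
    exact FirstOrder.Language.Substructure.subset_closure ⟨k, rfl⟩
  have hmem : ∀ x : A, i x ∈ S := fun x => show x ∈ T from hT ▸ trivial
  exact Finite.of_injective (fun x : A => (⟨i x, hmem x⟩ : S)) fun x y h =>
    (isOpensEmbedding_inclHom A).injective (congrArg Subtype.val h)

/-! ### Transfer of projectivity -/

section Projectivity

variable {H : Type u} [HeytingAlgebra H] {M : Type u} [InteriorAlgebra M]
  {e : BoundedLatticeHom H M}

/-- Restrict the lifting problem to open elements, solve it in `V`, and extend the solution; it is
correct because it is so on the generating open elements. -/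
theorem InteriorAlgebra.IsOpensEmbedding.isProjectiveIn_rhoStar (hV : IsVariety V)
    (he : IsOpensEmbedding e) (hgen : BooleanSubalgebra.closure (Set.range e) = ⊤)
    (hM : ofInterior M ∈ rhoStar V) (hP : IsProjectiveIn V (ofHeyting H)) :
    IsProjectiveIn (rhoStar V) (ofInterior M) := by
  refine ⟨hM, fun C hC D hD p f hp => ?_⟩
  obtain ⟨C, _, rfl, -, hCV⟩ := exists_eq_ofInterior_of_mem_rhoStar hV hC
  obtain ⟨D, _, rfl, -, hDV⟩ := exists_eq_ofInterior_of_mem_rhoStar hV hD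
  have hc := Opens.isOpensEmbedding_val (M := C)
  have hd := Opens.isOpensEmbedding_val (M := D)
  obtain ⟨p', hp'⟩ := hc.exists_restrict hd p
  obtain ⟨f', hf'⟩ := he.exists_restrict hd f
  obtain ⟨g', hg'⟩ := hP.2 _ hCV _ hDV p' f' (hc.surjective_restrict hd hp hp')
  obtain ⟨g, hg⟩ := he.exists_lift hgen hc g'
  refine ⟨g, IsOpensEmbedding.hom_ext hgen (g := p.comp g) fun x => ?_⟩
  exact (congrArg p (hg x)).trans ((hp' _).symm.trans
    ((congrArg (Opens.val D) (hg' x)).trans (hf' x)))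

/-- Apply `𝓑` to the lifting problem, which keeps the surjection surjective, and restrict the
solution to open elements. -/
theorem InteriorAlgebra.IsOpensEmbedding.isProjectiveIn_of_rhoStar
    (hHA : V ⊆ heytingAlgebras)
    (he : IsOpensEmbedding e) (hgen : BooleanSubalgebra.closure (Set.range e) = ⊤)
    (hH : ofHeyting H ∈ V) (hP : IsProjectiveIn (rhoStar V) (ofInterior M)) :
    IsProjectiveIn V (ofHeyting H) := by
  refine ⟨hH, fun C hC D hD p f hp => ?_⟩
  obtain ⟨C, _, rfl⟩ := hHA hC
  obtain ⟨D, _, rfl⟩ := hHA hD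
  have hc := isOpensEmbedding_inclHom C
  have hd := isOpensEmbedding_inclHom D
  obtain ⟨p', hp'⟩ := hc.exists_lift (closure_range_inclHom C) hd p
  obtain ⟨f', hf'⟩ := he.exists_lift hgen hd f
  obtain ⟨g', hg'⟩ := hP.2 _ (ofInterior_freeBooleanExtension_mem hC) _
    (ofInterior_freeBooleanExtension_mem hD) p' f'
    (IsOpensEmbedding.surjective_of_forall_mem_range (closure_range_inclHom D) fun x => by
      obtain ⟨y, rfl⟩ := hp x
      exact ⟨_, hp' y⟩)
  obtain ⟨g, hg⟩ := he.exists_restrict hc g'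
  refine ⟨g, fun x => hd.injective ?_⟩
  exact (hp' (g x)).symm.trans ((congrArg p' (hg x)).trans ((hg' _).trans (hf' x)))

end Projectivity

/-! ### Unifiers -/

variable {A : Type u} [HeytingAlgebra A]

/-- A unifier of `A` corresponds to a unifier of `𝓑(A)` if its target is, up to isomorphism, the
algebra of open elements of the target of the latter, and if this algebra generates the target. -/
inductive Unifier.Corresponds : Unifier V (ofHeyting A) →
    Unifier (rhoStar V) (ofInterior (FreeBooleanExtension A)) → Prop
  | mk {H : Type u} [HeytingAlgebra H] {M : Type u} [InteriorAlgebra M]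
    (e : BoundedLatticeHom H M) (he : IsOpensEmbedding e)
    (hgen : BooleanSubalgebra.closure (Set.range e) = ⊤)
    (f : ofHeyting A →[heytingLanguage] ofHeyting H)
    (g : ofInterior (FreeBooleanExtension A) →[interiorLanguage] ofInterior M)
    (hfg : ∀ a : A, e (f a) = g (inclHom A a))
    (hf : IsFinitelyPresentedIn V (ofHeyting H)) (hp : IsProjectiveIn V (ofHeyting H))
    (hf' : IsFinitelyPresentedIn (rhoStar V) (ofInterior M))
    (hp' : IsProjectiveIn (rhoStar V) (ofInterior M)) :
    Corresponds ⟨ofHeyting H, f, hf, hp⟩ ⟨ofInterior M, g, hf', hp'⟩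

/-- The partner has target `𝓑(H)`, which is finite because `H` is. -/
theorem Unifier.exists_corresponds_right (hV : IsVariety V) (hHA : V ⊆ heytingAlgebras)
    (hfin : IsLocallyFiniteClass (rhoStar V)) (x : Unifier V (ofHeyting A)) :
    ∃ y, x.Corresponds y := by
  obtain ⟨H, f, hf, hp⟩ := x
  obtain ⟨H, _, rfl⟩ := hHA hf.1
  have he := isOpensEmbedding_inclHom H
  have hgen := closure_range_inclHom H
  have hH := ofInterior_freeBooleanExtension_mem hf.1
  obtain ⟨g, hg⟩ := (isOpensEmbedding_inclHom A).exists_lift (closure_range_inclHom A) he f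
  have : Finite H := finite_of_isFinitelyPresentedIn hfin hf
  have : Finite (ofInterior (FreeBooleanExtension H)) :=
    inferInstanceAs (Finite (FreeBooleanExtension H))
  exact ⟨_, .mk (inclHom H) he hgen f g (fun a => (hg a).symm) hf hp
    (isFinitelyPresentedIn_of_finite hH) (he.isProjectiveIn_rhoStar hV hgen hH hp)⟩

/-- The partner has the open elements of `M` as target. They generate `M` because `M` is a finite
Grzegorczyk algebra. -/
theorem Unifier.exists_corresponds_left (hV : IsVariety V) (hHA : V ⊆ heytingAlgebras)
    (hfin : IsLocallyFiniteClass (rhoStar V))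
    (y : Unifier (rhoStar V) (ofInterior (FreeBooleanExtension A))) :
    ∃ x : Unifier V (ofHeyting A), x.Corresponds y := by
  obtain ⟨M, g, hf, hp⟩ := y
  obtain ⟨M, _, rfl, hM, hMV⟩ := exists_eq_ofInterior_of_mem_rhoStar hV hf.1
  have : Finite M := hf.finite hfin
  have he := Opens.isOpensEmbedding_val (M := M)
  have hgen := hM.closure_range_val
  obtain ⟨f, hfg⟩ := (isOpensEmbedding_inclHom A).exists_restrict he g
  have : Finite (ofHeyting (Opens M)) := Finite.of_injective (Opens.val M) he.injective
  exact ⟨_, .mk (Opens.val M) he hgen f g hfg (isFinitelyPresentedIn_of_finite hMV)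
    (he.isProjectiveIn_of_rhoStar hHA hgen hMV hp) hf hp⟩

theorem Unifier.Corresponds.moreGeneral_iff {x x' : Unifier V (ofHeyting A)}
    {y y' : Unifier (rhoStar V) (ofInterior (FreeBooleanExtension A))}
    (h : x.Corresponds y) (h' : x'.Corresponds y') : x'.MoreGeneral x ↔ y'.MoreGeneral y := by
  obtain ⟨e, he, hgen, f, g, hfg⟩ := h
  obtain ⟨e', he', hgen', f', g', hfg'⟩ := h'
  constructor
  · rintro ⟨k, hk⟩
    obtain ⟨l, hl⟩ := he'.exists_lift hgen' he k
    refine ⟨l, IsOpensEmbedding.hom_ext (closure_range_inclHom A) (g := l.comp g')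
      fun a => ?_⟩
    exact (congrArg l (hfg' a)).symm.trans ((hl _).trans ((congrArg e (hk a)).trans (hfg a)))
  · rintro ⟨l, hl⟩
    obtain ⟨k, hk⟩ := he'.exists_restrict he l
    refine ⟨k, fun a => he.injective ?_⟩
    exact (hk _).trans ((congrArg l (hfg' a)).trans ((hl _).trans (hfg a).symm))

end RhoStar

theorem mainTheorem1 (V : Set (Alg.{u} heytingLanguage)) (hV : IsVariety V)
    (hHA : V ⊆ heytingAlgebras) (hfin : IsLocallyFiniteClass (rhoStar V))
    (A : Type u) [HeytingAlgebra A] (hA : ofHeyting A ∈ V) (t : UnificationType) :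
    HasUnificationType V (ofHeyting A) t ↔
      HasUnificationType (rhoStar V) (ofInterior (FreeBooleanExtension A)) t := by
  refine and_congr ⟨fun h => ?_, fun h => ?_⟩
    (quasiorderHasType_iff_of_rel (r := fun x y => y.MoreGeneral x)
      (s := fun x y => y.MoreGeneral x) Unifier.MoreGeneral.refl Unifier.MoreGeneral.refl
      (Unifier.exists_corresponds_right hV hHA hfin)
      (Unifier.exists_corresponds_left hV hHA hfin)
      (fun _ _ _ _ h h' => h.moreGeneral_iff h') t)
  -- Being finitely presented means being finite on both sides, and `A` is finite exactly when
  -- `𝓑(A)` is.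
  · have : Finite A := finite_of_isFinitelyPresentedIn hfin h
    have : Finite (ofInterior (FreeBooleanExtension A)) :=
      inferInstanceAs (Finite (FreeBooleanExtension A))
    exact isFinitelyPresentedIn_of_finite (ofInterior_freeBooleanExtension_mem hA)
  · have : Finite (FreeBooleanExtension A) := h.finite hfin
    have : Finite (ofHeyting A) :=
      Finite.of_injective _ (FreeBooleanExtension.isOpensEmbedding_inclHom A).injective
    exact isFinitelyPresentedIn_of_finite hA
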